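/- **Setting.** Let $\mathfrak A$ be a (not necessarily unital) $C^*$-algebra and $H$ a Hilbert $\mathfrak A$-module. Let $\mathcal L(H)$ be the $C^*$-algebra of adjointable operators on $H$, with identity $I$. For $T\in\mathcal L(H)$ write $\mathcal R(T)$ and $\mathcal N(T)$ for its range and null space, and $|T|=(T^*T)^{1/2}$. A closed submodule $M\subseteq H$ is *orthogonally complemented* if $H=M+M^\perp$; in that case $P_M$ denotes the projection (self-adjoint idempotent) of $H$ onto $M$. A *polar decomposition* of $T$ is a factorization $T=V|T|$ with $V\in\mathcal L(H)$ a partial isometry such that $\overline{\mathcal R(T^*)}$ is orthogonally complemented and $V^*V=P_{\overline{\mathcal R(T^*)}}$ (such a $V$ is unique if it exists). A pair $(P,Q)$ with $P\in\mathcal L(H)$ a projection and $Q\in\mathcal L(H)$ an idempotent is a *quasi-projection pair* if $$PQ^*P=PQP,\qquad PQ^*(I-P)=-PQ(I-P),\qquad (I-P)Q^*(I-P)=(I-P)Q(I-P).$$ Put $$T_1=P(I-Q),\quad T_2=(I-P)Q,\quad H_1=\mathcal R(P)\cap\mathcal R(Q),\quad H_4=\mathcal N(P)\cap\mathcal N(Q).$$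 A quasi-projection pair $(P,Q)$ is *semi-harmonious* if $T_1$ and $T_2$ both have polar decompositions. **Theorem.** Let $(P,Q)$ be a semi-harmonious quasi-projection pair on $H$, and let $T_i=V_i|T_i|$ $(i=1,2)$ be the polar decompositions. Then $H_1$ and $H_4$ are orthogonally complemented in $H$, and for all $\lambda_1,\lambda_2,\lambda_3\in\mathbb C$ with $|\lambda_1|=|\lambda_2|=|\lambda_3|=1$ the operator $$U=\lambda_1\big[V_1(2P-I)-V_2\big]+\lambda_2P_{H_1}+\lambda_3P_{H_4}$$ is unitary and satisfies $$U(P-P_{H_1})(Q-P_{H_1})U^*=(I-Q-P_{H_4})(I-P-P_{H_4}).$$ -/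

import Mathlib

/-!
A Hilbert module over a C⋆-algebra `A` is a complete space `E` with a `CStarModule A E` structure.
The inner product is linear in its second argument and `a • y` satisfies
`⟨x, a • y⟩ = a * ⟨x, y⟩`; a right Hilbert `B`-module in the convention `⟨x, y b⟩ = ⟨x, y⟩ b` is
precisely such a module with `A` the opposite algebra of `B`. Adjoints, projections and
orthogonal complements do not depend on the choice between these two conventions.
-/

namespace HilbertModule

section Adjointable

variable (A E : Type*) [NonUnitalCStarAlgebra A] [PartialOrder A] [StarOrderedRing A]
  [NormedAddCommGroup E] [NormedSpace ℂ E] [SMul A E] [CStarModule A E]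

variable {E} in
/-- Two vectors with the same inner products against every vector are equal. -/
theorem ext_inner {x y : E} (h : ∀ z : E, inner A x z = inner A y z) : x = y := by
  have h0 : inner A (x - y) (x - y) = 0 := by
    rw [CStarModule.inner_sub_left, h, sub_self]
  exact sub_eq_zero.mp (CStarModule.inner_self.mp h0)

/-- The algebra `𝓛(E)` of all adjointable operators on the Hilbert `A`-module `E`. (An adjointable
operator is automatically bounded, `ℂ`-linear and `A`-linear.) -/
def adjointable : Subalgebra ℂ (E →L[ℂ] E) where
  carrier := {T | ∃ S : E →L[ℂ] E, ∀ x y : E, inner A (T x) y = inner A x (S y)}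
  mul_mem' := by
    rintro T T' ⟨S, hS⟩ ⟨S', hS'⟩
    exact ⟨S' * S, fun x y => by
      rw [mul_apply_eq_comp, mul_apply_eq_comp, hS, hS']⟩
  add_mem' := by
    rintro T T' ⟨S, hS⟩ ⟨S', hS'⟩
    exact ⟨S + S', fun x y => by simp [hS, hS']⟩
  algebraMap_mem' := fun c => ⟨algebraMap ℂ (E →L[ℂ] E) (star c), fun x y => by
    simp [Algebra.algebraMap_eq_smul_one]⟩

/-- `𝓛(E)`. -/
abbrev Adj : Type _ := ↥(adjointable A E)

variable {A E}

theorem Adj.ext_inner {S T : Adj A E}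
    (h : ∀ x y : E, inner A (S.1 x) y = inner A (T.1 x) y) : S = T :=
  Subtype.ext (ContinuousLinearMap.ext fun x => HilbertModule.ext_inner A fun z => h x z)

/-- The adjoint `T⋆`, characterised by `inner_adj_left`. -/
noncomputable def adj (T : Adj A E) : Adj A E :=
  ⟨T.2.choose, T.1, fun x y => by
    rw [← CStarModule.star_inner, ← T.2.choose_spec, CStarModule.star_inner]⟩

noncomputable instance : Star (Adj A E) := ⟨adj⟩

theorem inner_adj_left (T : Adj A E) (x y : E) :
    inner A (T.1 x) y = inner A x ((star T).1 y) := T.2.choose_spec x y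

theorem inner_adj_right (T : Adj A E) (x y : E) :
    inner A ((star T).1 x) y = inner A x (T.1 y) := by
  rw [← CStarModule.star_inner, ← inner_adj_left, CStarModule.star_inner]

noncomputable instance : StarRing (Adj A E) where
  star_involutive T := Adj.ext_inner fun x y => by
    rw [inner_adj_right, ← inner_adj_left]
  star_mul S T := Adj.ext_inner fun x y => by
    rw [inner_adj_right]
    change inner A x (S.1 (T.1 y)) = inner A ((star T).1 ((star S).1 x)) y
    rw [inner_adj_right, inner_adj_right]
  star_add S T := Adj.ext_inner fun x y => by
    rw [inner_adj_right]
    change inner A x (S.1 y + T.1 y) = inner A ((star S).1 x + (star T).1 x) y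
    rw [CStarModule.inner_add_left, CStarModule.inner_add_right, inner_adj_right, inner_adj_right]

instance : StarModule ℂ (Adj A E) where
  star_smul c T := Adj.ext_inner fun x y => by
    rw [inner_adj_right]
    change inner A x (c • T.1 y) = inner A (star c • (star T).1 x) y
    rw [CStarModule.inner_smul_left_complex, CStarModule.inner_smul_right_complex,
      inner_adj_right, star_star]

instance : CStarRing (Adj A E) where
  norm_mul_self_le T := by
    have h : ‖T.1‖ ≤ √‖star T * T‖ := by
      refine T.1.opNorm_le_bound (Real.sqrt_nonneg _) fun x => ?_
      rw [← Real.sqrt_sq (norm_nonneg x), ← Real.sqrt_mul (norm_nonneg (star T * T))]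
      refine Real.le_sqrt_of_sq_le ?_
      rw [CStarModule.norm_sq_eq A, inner_adj_left]
      calc ‖inner A x ((star T).1 (T.1 x))‖ ≤ ‖x‖ * ‖(star T * T).1 x‖ :=
            CStarModule.norm_inner_le E
        _ ≤ ‖x‖ * (‖star T * T‖ * ‖x‖) := by
            gcongr
            exact (star T * T).1.le_opNorm x
        _ = ‖star T * T‖ * ‖x‖ ^ 2 := by ring
    calc ‖T‖ * ‖T‖ ≤ √‖star T * T‖ * √‖star T * T‖ := by gcongr <;> exact h
      _ = ‖star T * T‖ := Real.mul_self_sqrt (norm_nonneg _)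

theorem isClosed_adjointable [CompleteSpace E] :
    IsClosed (adjointable A E : Set (E →L[ℂ] E)) := by
  refine isClosed_of_closure_subset fun T hT => ?_
  obtain ⟨u, hu, hlim⟩ := mem_closure_iff_seq_limit.mp hT
  let v : ℕ → Adj A E := fun n => ⟨u n, hu n⟩
  have hc : CauchySeq fun n => (star (v n)).1 := by
    refine Metric.cauchySeq_iff'.mpr fun ε hε => ?_
    obtain ⟨N, hN⟩ := Metric.cauchySeq_iff'.mp hlim.cauchySeq ε hε
    refine ⟨N, fun n hn => ?_⟩
    have h1 : dist (star (v n)).1 (star (v N)).1 = dist (u n) (u N) := by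
      rw [dist_eq_norm, dist_eq_norm]
      have h2 : ‖star (v n - v N)‖ = ‖v n - v N‖ := norm_star (v n - v N)
      rw [star_sub] at h2
      exact h2
    rw [h1]
    exact hN n hn
  obtain ⟨S, hS⟩ := cauchySeq_tendsto_of_complete hc
  refine ⟨S, fun x y => ?_⟩
  have hc := CStarModule.continuous_inner (A := A) (E := E)
  have e1 : Filter.Tendsto (fun n => inner A (u n x) y) Filter.atTop (nhds (inner A (T x) y)) :=
    (hc.tendsto (T x, y)).comp
      ((((ContinuousLinearMap.apply ℂ E x).continuous.tendsto T).comp hlim).prodMk_nhds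
        tendsto_const_nhds)
  have e2 : Filter.Tendsto (fun n => inner A x ((star (v n)).1 y)) Filter.atTop
      (nhds (inner A x (S y))) :=
    (hc.tendsto (x, S y)).comp (tendsto_const_nhds.prodMk_nhds
      (((ContinuousLinearMap.apply ℂ E y).continuous.tendsto S).comp hS))
  refine tendsto_nhds_unique e1 (e2.congr fun n => ?_)
  exact (inner_adj_left (v n) x y).symm

variable [CompleteSpace E]

instance : CompleteSpace (Adj A E) := isClosed_adjointable.completeSpace_coe

noncomputable instance : CStarAlgebra (Adj A E) where

/-- The order of the C⋆-algebra `𝓛(E)`: `S ≤ T` if and only if `T - S` is a positive element. -/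
noncomputable instance : PartialOrder (Adj A E) := CStarAlgebra.spectralOrder _

instance : StarOrderedRing (Adj A E) := CStarAlgebra.spectralOrderedRing _

end Adjointable

section Submodules

variable (A : Type*) {E : Type*} [NonUnitalCStarAlgebra A] [PartialOrder A] [StarOrderedRing A]
  [NormedAddCommGroup E] [NormedSpace ℂ E] [SMul A E] [CStarModule A E]

/-- `Mᗮ = {x | ⟨x, y⟩ = 0 for every y ∈ M}`. -/
def orthogonal (M : Submodule ℂ E) : Submodule ℂ E where
  carrier := {x | ∀ y ∈ M, inner A x y = 0}
  add_mem' := fun hx hx' y hy => by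
    rw [CStarModule.inner_add_left, hx y hy, hx' y hy, add_zero]
  zero_mem' := fun y _ => CStarModule.inner_zero_left
  smul_mem' := fun c x hx y hy => by
    rw [CStarModule.inner_smul_left_complex, hx y hy, smul_zero]

/-- `M` is orthogonally complemented: `M` is closed and `E = M + Mᗮ`. (Such an `M` equals `Mᗮᗮ`,
so it is automatically a submodule for the action of `A`.) -/
def IsOrthogonallyComplemented (M : Submodule ℂ E) : Prop :=
  IsClosed (M : Set E) ∧ M ⊔ orthogonal A M = ⊤

variable {A}

/-- The range `𝓡(T)`. -/
def range (T : Adj A E) : Submodule ℂ E := LinearMap.range (T.1 : E →ₗ[ℂ] E)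

/-- The null space `𝓝(T)`. -/
def ker (T : Adj A E) : Submodule ℂ E := LinearMap.ker (T.1 : E →ₗ[ℂ] E)

/-- An orthogonally complemented submodule is the range of exactly one projection. -/
theorem IsOrthogonallyComplemented.existsUnique {M : Submodule ℂ E}
    (hM : IsOrthogonallyComplemented A M) :
    ∃! p : Adj A E, IsStarProjection p ∧ range p = M := by
  have hdisj : Disjoint M (orthogonal A M) := by
    rw [Submodule.disjoint_def]
    exact fun x hx hx' => CStarModule.inner_self.mp (hx' x hx)
  have hc : IsCompl M (orthogonal A M) := ⟨hdisj, codisjoint_iff.mpr hM.2⟩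
  have hdec : ∀ x : E, ∃ m ∈ M, ∃ n ∈ orthogonal A M, m + n = x := fun x =>
    Submodule.mem_sup.mp (hM.2 ▸ Submodule.mem_top)
  let f : E →ₗ[ℂ] E := M.subtype ∘ₗ M.projectionOnto (orthogonal A M) hc
  have hf : ∀ m ∈ M, ∀ n ∈ orthogonal A M, f (m + n) = m := fun m hm n hn => by
    have h1 : M.projectionOnto (orthogonal A M) hc m = ⟨m, hm⟩ :=
      Submodule.projectionOnto_apply_left hc ⟨m, hm⟩
    have h2 : M.projectionOnto (orthogonal A M) hc n = 0 :=
      (Submodule.projectionOnto_apply_eq_zero_iff hc).mpr hn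
    simp [f, h1, h2]
  have hort : ∀ m ∈ M, ∀ n ∈ orthogonal A M, inner A m n = 0 := fun m hm n hn => by
    rw [← CStarModule.star_inner, hn m hm, star_zero]
  have hself : ∀ x y : E, inner A (f x) y = inner A x (f y) := fun x y => by
    obtain ⟨m, hm, n, hn, rfl⟩ := hdec x
    obtain ⟨m', hm', n', hn', rfl⟩ := hdec y
    rw [hf m hm n hn, hf m' hm' n' hn', CStarModule.inner_add_right, CStarModule.inner_add_left,
      hort m hm n' hn', hn m' hm']
  have hbd : ∀ x, ‖f x‖ ≤ 1 * ‖x‖ := fun x => by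
    obtain ⟨m, hm, n, hn, rfl⟩ := hdec x
    rw [hf m hm n hn, one_mul, CStarModule.norm_eq_sqrt_norm_inner_self (A := A) m,
      CStarModule.norm_eq_sqrt_norm_inner_self (A := A) (m + n)]
    refine Real.sqrt_le_sqrt
      (CStarAlgebra.norm_le_norm_of_nonneg_of_le CStarModule.inner_self_nonneg ?_)
    rw [CStarModule.inner_add_right, CStarModule.inner_add_left, CStarModule.inner_add_left,
      hort m hm n hn, hn m hm, add_zero, zero_add]
    exact le_add_of_nonneg_right CStarModule.inner_self_nonneg
  let F : E →L[ℂ] E := f.mkContinuous 1 hbd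
  have hF : ∀ x, F x = f x := fun _ => rfl
  have hmem : ∀ x, f x ∈ M := fun x => (M.projectionOnto (orthogonal A M) hc x).2
  have hid : ∀ m ∈ M, f m = m := fun m hm => by
    simpa using hf m hm 0 (Submodule.zero_mem _)
  let p : Adj A E := ⟨F, F, hself⟩
  refine ⟨p, ⟨⟨?_, ?_⟩, ?_⟩, ?_⟩
  · refine Subtype.ext (ContinuousLinearMap.ext fun x => ?_)
    exact hid _ (hmem x)
  · refine Adj.ext_inner fun x y => ?_
    rw [inner_adj_right]
    exact (hself x y).symm
  · ext x
    constructor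
    · rintro ⟨y, rfl⟩
      exact hmem y
    · exact fun hx => ⟨x, hid x hx⟩
  · rintro q ⟨hq, hqM⟩
    have hqq : ∀ x, q.1 (q.1 x) = q.1 x := fun x =>
      congrArg (fun T : Adj A E => T.1 x) hq.isIdempotentElem
    have hqs : star q = q := hq.isSelfAdjoint
    refine Subtype.ext (ContinuousLinearMap.ext fun x => ?_)
    have h1 : q.1 x ∈ M := hqM ▸ (⟨x, rfl⟩ : q.1 x ∈ range q)
    have h2 : x - q.1 x ∈ orthogonal A M := fun y hy => by
      obtain ⟨z, rfl⟩ : y ∈ range q := hqM ▸ hy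
      change inner A (x - q.1 x) (q.1 z) = 0
      rw [← inner_adj_right, hqs, map_sub, hqq, sub_self, CStarModule.inner_zero_left]
    have h3 := hf _ h1 _ h2
    rw [add_sub_cancel] at h3
    exact h3.symm

/-- The projection `P_M` onto an orthogonally complemented submodule `M`. -/
noncomputable def projOnto (M : Submodule ℂ E) (hM : IsOrthogonallyComplemented A M) : Adj A E :=
  hM.existsUnique.choose

theorem projOnto_spec (M : Submodule ℂ E) (hM : IsOrthogonallyComplemented A M) :
    IsStarProjection (projOnto M hM) ∧ range (projOnto M hM) = M :=
  hM.existsUnique.choose_spec.1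

end Submodules

section Pairs

variable {A E : Type*} [NonUnitalCStarAlgebra A] [PartialOrder A] [StarOrderedRing A]
  [NormedAddCommGroup E] [NormedSpace ℂ E] [SMul A E] [CStarModule A E]

/-- `T = V|T|` is the polar decomposition of `T`: `V` is a partial isometry, `T = V|T|` with
`|T| = (T⋆T)^(1/2)`, and `V⋆V` is the projection onto the closure of `𝓡(T⋆)` (in particular that
closure is orthogonally complemented). -/
structure IsPolarDecomposition [CompleteSpace E] (T V : Adj A E) : Prop where
  partialIsometry : V * star V * V = V
  eq_mul_abs : T = V * CFC.abs T
  star_mul_self : ∃ h : IsOrthogonallyComplemented A (range (star T)).topologicalClosure,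
    star V * V = projOnto (range (star T)).topologicalClosure h

/-- `(P, Q)` is a quasi-projection pair. -/
structure IsQuasiProjectionPair (P Q : Adj A E) : Prop where
  isStarProjection : IsStarProjection P
  isIdempotentElem : IsIdempotentElem Q
  corner₁₁ : P * star Q * P = P * Q * P
  corner₁₂ : P * star Q * (1 - P) = -(P * Q * (1 - P))
  corner₂₂ : (1 - P) * star Q * (1 - P) = (1 - P) * Q * (1 - P)

/-- `T₁ = P(I - Q)`. -/
noncomputable def T₁ (P Q : Adj A E) : Adj A E := P * (1 - Q)

/-- `T₂ = (I - P)Q`. -/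
noncomputable def T₂ (P Q : Adj A E) : Adj A E := (1 - P) * Q

/-- `H₁ = 𝓡(P) ∩ 𝓡(Q)`. -/
def H₁ (P Q : Adj A E) : Submodule ℂ E := range P ⊓ range Q

/-- `H₄ = 𝓝(P) ∩ 𝓝(Q)`. -/
def H₄ (P Q : Adj A E) : Submodule ℂ E := ker P ⊓ ker Q

/-- A quasi-projection pair is semi-harmonious if `T₁` and `T₂` both have polar decompositions. -/
structure IsSemiHarmonious [CompleteSpace E] (P Q : Adj A E) : Prop where
  isQuasiProjectionPair : IsQuasiProjectionPair P Q
  polar₁ : ∃ V : Adj A E, IsPolarDecomposition (T₁ P Q) V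
  polar₂ : ∃ V : Adj A E, IsPolarDecomposition (T₂ P Q) V

end Pairs

end HilbertModule

/-! Put J = 2P - I. The quasi-projection identities say exactly that Q* = JQJ. Once the closed range
in a polar decomposition is replaced by equality of the right annihilators of T and V, most of the
argument is algebra in a C*-algebra.

The projections onto H₁ and H₄ are P₁ = P - V₁V₁* and P₄ = I - P - V₂V₂*: a vector of R(P) killed by
T₁* is fixed by Q* = JQJ, hence by Q; a vector of N(P) killed by T₂* is likewise killed by Q.

Let W = V₁J - V₂. Since T₁JT₂* = 0, WW* = I - P₁ - P₄, so U is a coisometry. The hard half of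
unitarity is injectivity: by `Q_mul_of_mul_eq_zero` the kernel of W lies in H₁ + H₄, where U acts by
unimodular scalars.

For the conjugation identity, let D = P - Q. Then R = |T₁*| + |T₂*| satisfies R² = 2D⁴ - D², which
commutes with P and Q, so R does too. Moreover RW = T₁J - T₂ intertwines PQ with (I - Q)(I - P) by
pure algebra, and cancelling R gives the same for W (`W_mul_PQ`). -/

namespace HilbertModule

/-! ### Polar factors in a C*-algebra -/

section CStarAlgebra

variable {B : Type*} [CStarAlgebra B] [PartialOrder B] [StarOrderedRing B]

/-- A partial isometry `V` with `T = V|T|` which has the same right annihilator as `T`. -/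
structure IsPolarFactor (T V : B) : Prop where
  partialIsometry : V * star V * V = V
  eq_mul_abs : T = V * CFC.abs T
  mul_eq_zero_iff : ∀ X, T * X = 0 ↔ V * X = 0

namespace IsPolarFactor

variable {T V : B}

theorem star_mul_mul_star (h : IsPolarFactor T V) : star V * V * star V = star V := by
  simpa [mul_assoc] using congrArg star h.partialIsometry

theorem star_eq_abs_mul (h : IsPolarFactor T V) : star T = CFC.abs T * star V := by
  conv_lhs => rw [h.eq_mul_abs]
  rw [star_mul, (CFC.abs_nonneg T).isSelfAdjoint.star_eq]

/-- Since TV* = V|T|V* = VT*, T*X = 0 gives TV*X = 0, hence VV*X = 0. This carries the annihilator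
condition over to the adjoints. -/
theorem star_mul_eq_zero (h : IsPolarFactor T V) {X : B} (hX : star T * X = 0) :
    star V * X = 0 := by
  have h2 : T * (star V * X) = 0 := by
    conv_lhs => rw [h.eq_mul_abs]
    rw [mul_assoc, ← mul_assoc (CFC.abs T), ← h.star_eq_abs_mul, hX, mul_zero]
  rw [← h.star_mul_mul_star, mul_assoc, mul_assoc, (h.mul_eq_zero_iff _).mp h2, mul_zero]

theorem left_mul_eq_zero (h : IsPolarFactor T V) {X : B} (hX : X * T = 0) : X * V = 0 := by
  have h1 : star T * star X = 0 := by rw [← star_mul, hX, star_zero]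
  simpa using congrArg star (h.star_mul_eq_zero h1)

theorem mul_star_mul_self (h : IsPolarFactor T V) : V * (star V * T) = T := by
  conv_lhs => rw [h.eq_mul_abs]
  rw [← mul_assoc, ← mul_assoc, h.partialIsometry, ← h.eq_mul_abs]

theorem abs_mul_star_mul_self (h : IsPolarFactor T V) :
    CFC.abs T * (star V * V) = CFC.abs T := by
  have h1 : T * (1 - star V * V) = 0 := by
    rw [h.mul_eq_zero_iff, mul_sub, mul_one, ← mul_assoc, h.partialIsometry, sub_self]
  have h2 : CFC.abs T * (1 - star V * V) = 0 := by
    rw [← CStarRing.star_mul_self_eq_zero_iff, star_mul,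
      (CFC.abs_nonneg T).isSelfAdjoint.star_eq, mul_assoc, ← mul_assoc (CFC.abs T),
      CFC.abs_mul_abs, mul_assoc, h1, mul_zero, mul_zero]
  rwa [mul_sub, mul_one, sub_eq_zero, eq_comm] at h2

theorem conj_abs_mul (h : IsPolarFactor T V) : V * CFC.abs T * star V * V = T := by
  rw [mul_assoc, mul_assoc, h.abs_mul_star_mul_self, ← h.eq_mul_abs]

/-- Together with positivity this identifies V|T|V* as |T*|. -/
theorem conj_abs_mul_self (h : IsPolarFactor T V) :
    V * CFC.abs T * star V * (V * CFC.abs T * star V) = T * star T := by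
  rw [← mul_assoc, ← mul_assoc, h.conj_abs_mul, mul_assoc, ← h.star_eq_abs_mul]

theorem conj_abs_nonneg (_ : IsPolarFactor T V) : 0 ≤ V * CFC.abs T * star V :=
  star_right_conjugate_nonneg (CFC.abs_nonneg T) V

theorem isStarProjection_mul_star (h : IsPolarFactor T V) : IsStarProjection (V * star V) where
  isIdempotentElem := by
    rw [IsIdempotentElem, ← mul_assoc, h.partialIsometry]
  isSelfAdjoint := .mul_star_self V

end IsPolarFactor

theorem commute_of_commute_mul_self {R X : B} (hR : 0 ≤ R) (h : Commute (R * R) X) :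
    Commute R X := by
  rw [← CFC.sqrt_mul_self R]
  exact h.cfcₙ_nnreal _

/-- Multiplying on the left by y* gives two positive elements with sum zero. -/
theorem eq_zero_of_add_mul_star_mul {c y : B} (h : y + c * (star c * y) = 0) : y = 0 := by
  have h1 : star y * y + star (star c * y) * (star c * y) = 0 := by
    rw [star_mul, star_star, mul_assoc (star y), ← mul_add, h, mul_zero]
  have h2 := (add_eq_zero_iff_of_nonneg (star_mul_self_nonneg y)
    (star_mul_self_nonneg (star c * y))).mp h1
  exact (CStarRing.star_mul_self_eq_zero_iff y).mp h2.1

/-! ### The projections P₁ and P₄ -/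

/-- The data `(P, Q, V₁, V₂)` of a semi-harmonious quasi-projection pair in a C⋆-algebra. -/
structure IsPolarPair (P Q V₁ V₂ : B) : Prop where
  proj : IsStarProjection P
  idem : IsIdempotentElem Q
  star_eq : star Q = (P + P - 1) * Q * (P + P - 1)
  polar₁ : IsPolarFactor (P * (1 - Q)) V₁
  polar₂ : IsPolarFactor ((1 - P) * Q) V₂

namespace IsPolarPair

variable {P Q V₁ V₂ : B}

theorem P_mul (h : IsPolarPair P Q V₁ V₂) (X : B) : P * (P * X) = P * X := by
  rw [← mul_assoc, h.proj.isIdempotentElem]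

theorem Q_mul (h : IsPolarPair P Q V₁ V₂) (X : B) : Q * (Q * X) = Q * X := by
  rw [← mul_assoc, h.idem]

theorem P_mul_V₁ (h : IsPolarPair P Q V₁ V₂) : P * V₁ = V₁ := by
  have h1 : (1 - P) * V₁ = 0 := h.polar₁.left_mul_eq_zero (by
    simp [sub_mul, h.P_mul])
  rwa [sub_mul, one_mul, sub_eq_zero, eq_comm] at h1

theorem P_mul_V₂ (h : IsPolarPair P Q V₁ V₂) : P * V₂ = 0 :=
  h.polar₂.left_mul_eq_zero (by simp [sub_mul, mul_sub, h.P_mul])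

theorem star_V₁_mul_P (h : IsPolarPair P Q V₁ V₂) : star V₁ * P = star V₁ := by
  simpa [h.proj.isSelfAdjoint.star_eq] using congrArg star h.P_mul_V₁

theorem star_V₂_mul_P (h : IsPolarPair P Q V₁ V₂) : star V₂ * P = 0 := by
  simpa [h.proj.isSelfAdjoint.star_eq] using congrArg star h.P_mul_V₂

theorem isStarProjection₁ (h : IsPolarPair P Q V₁ V₂) : IsStarProjection (P - V₁ * star V₁) where
  isIdempotentElem := by
    have h1 := h.polar₁.isStarProjection_mul_star.isIdempotentElem.eq
    rw [IsIdempotentElem, mul_sub, sub_mul, sub_mul, h1, h.proj.isIdempotentElem, mul_assoc,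
      h.star_V₁_mul_P, ← mul_assoc, h.P_mul_V₁]
    abel
  isSelfAdjoint := h.proj.isSelfAdjoint.sub h.polar₁.isStarProjection_mul_star.isSelfAdjoint

theorem isStarProjection₄ (h : IsPolarPair P Q V₁ V₂) :
    IsStarProjection (1 - P - V₂ * star V₂) where
  isIdempotentElem := by
    have h1 := h.polar₂.isStarProjection_mul_star.isIdempotentElem.eq
    have h2 : P * (V₂ * star V₂) = 0 := by rw [← mul_assoc, h.P_mul_V₂, zero_mul]
    have h3 : V₂ * star V₂ * P = 0 := by rw [mul_assoc, h.star_V₂_mul_P, mul_zero]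
    have h4 := h.proj.isIdempotentElem.one_sub.eq
    rw [IsIdempotentElem, mul_sub, sub_mul _ _ (V₂ * star V₂), h1, sub_mul 1 P (V₂ * star V₂),
      h2, sub_mul _ _ (1 - P), mul_sub (V₂ * star V₂), h3, h4]
    simp
  isSelfAdjoint := ((IsSelfAdjoint.one B).sub h.proj.isSelfAdjoint).sub
    h.polar₂.isStarProjection_mul_star.isSelfAdjoint

theorem P_mul_proj₁ (h : IsPolarPair P Q V₁ V₂) :
    P * (P - V₁ * star V₁) = P - V₁ * star V₁ := by
  rw [mul_sub, h.proj.isIdempotentElem, ← mul_assoc, h.P_mul_V₁]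

theorem P_mul_proj₄ (h : IsPolarPair P Q V₁ V₂) : P * (1 - P - V₂ * star V₂) = 0 := by
  rw [mul_sub, mul_sub, mul_one, h.proj.isIdempotentElem, ← mul_assoc, h.P_mul_V₂]
  simp

theorem symm_mul_symm (h : IsPolarPair P Q V₁ V₂) (X : B) :
    (P + P - 1) * ((P + P - 1) * X) = X := by
  simp only [add_mul, sub_mul, mul_add, mul_sub, h.P_mul, one_mul]
  abel

theorem Q_mul_of_star_Q_mul (h : IsPolarPair P Q V₁ V₂) {X : B} :
    (P + P - 1) * (star Q * X) = Q * ((P + P - 1) * X) := by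
  rw [h.star_eq, mul_assoc, mul_assoc, h.symm_mul_symm]

/-- V₁V₁*T₁ = T₁ yields T₁*P₁ = 0, that is Q*P₁ = P₁. As JP₁ = P₁, the relation Q* = JQJ turns this
into QP₁ = P₁. For P₄ the argument is the same with JP₄ = -P₄. -/
theorem Q_mul_proj₁ (h : IsPolarPair P Q V₁ V₂) :
    Q * (P - V₁ * star V₁) = P - V₁ * star V₁ := by
  have h1 : star (P * (1 - Q)) * (P - V₁ * star V₁) = 0 := by
    have h2 := congrArg star h.polar₁.mul_star_mul_self
    simp only [star_mul, star_star, star_sub, star_one, h.proj.isSelfAdjoint.star_eq] at h2 ⊢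
    rw [mul_sub, mul_assoc, h.proj.isIdempotentElem, ← mul_assoc, h2, sub_self]
  have h3 : star Q * (P - V₁ * star V₁) = P - V₁ * star V₁ := by
    rw [star_mul, mul_assoc, h.proj.isSelfAdjoint.star_eq, h.P_mul_proj₁, star_sub, star_one,
      sub_mul, one_mul, sub_eq_zero] at h1
    exact h1.symm
  have h4 := h.Q_mul_of_star_Q_mul (X := P - V₁ * star V₁)
  have h5 : (P + P - 1) * (P - V₁ * star V₁) = P - V₁ * star V₁ := by
    rw [sub_mul, add_mul, h.P_mul_proj₁]; simp
  rw [h3, h5] at h4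
  exact h4.symm

theorem Q_mul_proj₄ (h : IsPolarPair P Q V₁ V₂) : Q * (1 - P - V₂ * star V₂) = 0 := by
  have h1 : star ((1 - P) * Q) * (1 - P - V₂ * star V₂) = 0 := by
    have h2 := congrArg star h.polar₂.mul_star_mul_self
    simp only [star_mul, star_star, star_sub, star_one, h.proj.isSelfAdjoint.star_eq] at h2 ⊢
    rw [mul_sub, mul_assoc, h.proj.isIdempotentElem.one_sub.eq, ← mul_assoc, h2, sub_self]
  have h0 : (1 - P) * (1 - P - V₂ * star V₂) = 1 - P - V₂ * star V₂ := by
    rw [sub_mul, one_mul, h.P_mul_proj₄, sub_zero]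
  have h3 : star Q * (1 - P - V₂ * star V₂) = 0 := by
    rwa [star_mul, mul_assoc, star_sub, star_one, h.proj.isSelfAdjoint.star_eq, h0] at h1
  have h4 := h.Q_mul_of_star_Q_mul (X := 1 - P - V₂ * star V₂)
  have h5 : (P + P - 1) * (1 - P - V₂ * star V₂) = -(1 - P - V₂ * star V₂) := by
    rw [sub_mul, add_mul, h.P_mul_proj₄]; simp
  rw [h3, h5, mul_zero, mul_neg] at h4
  exact neg_eq_zero.mp h4.symm

theorem proj₁_mul (h : IsPolarPair P Q V₁ V₂) {X : B} (hP : P * X = X) (hQ : Q * X = X) :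
    (P - V₁ * star V₁) * X = X := by
  have h1 : star Q * X = X := by
    rw [h.star_eq, mul_assoc, mul_assoc]
    simp [sub_mul, add_mul, hP, hQ]
  have h2 : star V₁ * X = 0 := h.polar₁.star_mul_eq_zero (by
    rw [star_mul, h.proj.isSelfAdjoint.star_eq, mul_assoc, hP, star_sub, star_one, sub_mul, h1,
      one_mul, sub_self])
  rw [sub_mul, mul_assoc, h2, hP, mul_zero, sub_zero]

theorem proj₄_mul (h : IsPolarPair P Q V₁ V₂) {X : B} (hP : P * X = 0) (hQ : Q * X = 0) :
    (1 - P - V₂ * star V₂) * X = X := by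
  have h1 : star Q * X = 0 := by
    rw [h.star_eq, mul_assoc, mul_assoc]
    simp [sub_mul, add_mul, hP, hQ]
  have h2 : star V₂ * X = 0 := h.polar₂.star_mul_eq_zero (by
    rw [star_mul, mul_assoc, star_sub, star_one, sub_mul 1,
      h.proj.isSelfAdjoint.star_eq, hP, sub_zero, one_mul, h1])
  rw [sub_mul, sub_mul, mul_assoc, h2, hP, mul_zero, sub_zero, one_mul, sub_zero]

theorem proj₁_mul_P (h : IsPolarPair P Q V₁ V₂) :
    (P - V₁ * star V₁) * P = P - V₁ * star V₁ := by
  rw [sub_mul, h.proj.isIdempotentElem, mul_assoc, h.star_V₁_mul_P]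

theorem proj₄_mul_P (h : IsPolarPair P Q V₁ V₂) : (1 - P - V₂ * star V₂) * P = 0 := by
  rw [sub_mul, sub_mul, h.proj.isIdempotentElem, mul_assoc, h.star_V₂_mul_P]
  simp

/-! ### Commutation with T₁T₁* + T₂T₂* -/

theorem commute_P (h : IsPolarPair P Q V₁ V₂) :
    Commute (P * (1 - Q) * star (P * (1 - Q)) + (1 - P) * Q * star ((1 - P) * Q)) P := by
  simp only [Commute, SemiconjBy, star_mul, star_sub, h.star_eq,
    h.proj.isSelfAdjoint.star_eq, mul_add, add_mul, mul_sub, sub_mul, mul_assoc, h.P_mul, h.Q_mul,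
    h.proj.isIdempotentElem.eq, h.idem.eq, one_mul, mul_one]
  abel

/-- With D = P - Q, the element D² commutes with P and Q, and T₁T₁* = P(2D⁴ - D²), T₂T₂* = (I -
P)(2D⁴ - D²). The sum is 2D⁴ - D². -/
theorem commute_Q (h : IsPolarPair P Q V₁ V₂) :
    Commute (P * (1 - Q) * star (P * (1 - Q)) + (1 - P) * Q * star ((1 - P) * Q)) Q := by
  simp only [Commute, SemiconjBy, star_mul, star_sub, h.star_eq,
    h.proj.isSelfAdjoint.star_eq, mul_add, add_mul, mul_sub, sub_mul, mul_assoc, h.P_mul, h.Q_mul,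
    h.proj.isIdempotentElem.eq, h.idem.eq, one_mul, mul_one]
  abel

theorem star_V₁_mul_V₂ (h : IsPolarPair P Q V₁ V₂) : star V₁ * V₂ = 0 := by
  rw [← h.star_V₁_mul_P, mul_assoc, h.P_mul_V₂, mul_zero]

theorem star_V₂_mul_V₁ (h : IsPolarPair P Q V₁ V₂) : star V₂ * V₁ = 0 := by
  simpa using congrArg star h.star_V₁_mul_V₂

/-! ### The common kernel of T₁J and T₂ -/

/-- The vectors annihilated by both `T₁(2P - I)` and `T₂` are those of `H₁ + H₄`. -/
theorem Q_mul_of_mul_eq_zero (h : IsPolarPair P Q V₁ V₂) {X : B}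
    (h₁ : P * (1 - Q) * ((P + P - 1) * X) = 0) (h₂ : (1 - P) * Q * X = 0) :
    Q * (P * X) = P * X ∧ Q * (X - P * X) = 0 := by
  obtain ⟨u, hu⟩ : ∃ u, u = P * X := ⟨_, rfl⟩
  obtain ⟨v, hv⟩ : ∃ v, v = X - P * X := ⟨_, rfl⟩
  obtain rfl : X = u + v := by rw [hu, hv]; abel
  have hPu : P * u = u := by rw [hu, h.P_mul]
  have hPv : P * v = 0 := by rw [hv, mul_sub, h.P_mul, sub_self]
  rw [← hv, ← hu]
  clear hu hv
  have e1 : u - P * (Q * u) = -(P * (Q * v)) := by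
    simp only [mul_add, add_mul, mul_sub, sub_mul, mul_assoc, hPu, hPv, mul_one, one_mul,
      mul_zero] at h₁
    rw [← sub_eq_zero, ← h₁]
    abel
  have e2 : Q * v - P * (Q * v) = -(Q * u - P * (Q * u)) := by
    simp only [mul_add, sub_mul, mul_assoc, one_mul] at h₂
    rw [← sub_eq_zero, ← h₂]
    abel
  -- The defect y = u - PQu also equals -PQv; the aim is y = 0.
  obtain ⟨y, hy⟩ : ∃ y, y = u - P * (Q * u) := ⟨_, rfl⟩
  have hPy : P * y = y := by rw [hy, mul_sub, h.P_mul, hPu]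
  -- Applying PQ to `e2` shows that y is an eigenvector of a = PQP for the eigenvalue 1/2.
  have hyy : y = P * (Q * y) + P * (Q * y) := by
    have e3 : P * (Q * v) - P * (Q * (P * (Q * v))) = -(P * (Q * y)) := by
      have e4 := congrArg (fun Z => P * (Q * Z)) e2
      simp only [mul_sub, mul_neg, h.Q_mul] at e4
      rw [e4, hy, mul_sub, mul_sub]
    have e5 : P * (Q * v) = -y := by rw [hy, e1, neg_neg]
    rw [e5, mul_neg, mul_neg, sub_neg_eq_add, neg_add_eq_iff_eq_add] at e3
    nth_rw 1 [← sub_eq_zero]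
    rw [← neg_eq_zero]
    nth_rw 1 [e3]
    abel
  -- The off-diagonal blocks of Q are skew: b = PQ(I - P) has b* = -(I - P)QP.
  have hstar : ∀ Z, P * Z = Z →
      star (P * Q * (1 - P)) * Z = -(Q * Z - P * (Q * Z)) := fun Z hZ => by
    simp only [star_mul, star_sub, star_one, h.star_eq, h.proj.isSelfAdjoint.star_eq, mul_assoc,
      sub_mul, add_mul, mul_add, mul_sub, one_mul, hZ, h.P_mul]
    abel
  have hy0 : y = 0 := by
    -- Idempotency of Q gives a - a² = -bb*. At the eigenvalue 1/2 this reads y/4 + bb*y = 0, so c =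
    -- 2b.
    refine eq_zero_of_add_mul_star_mul (c := P * Q * (1 - P) + P * Q * (1 - P)) ?_
    rw [star_add, add_mul (star _), hstar y hPy]
    obtain ⟨w, hw⟩ : ∃ w, w = P * (Q * y) := ⟨_, rfl⟩
    have hw2 : w = P * (Q * w) + P * (Q * w) := by
      nth_rw 1 [hw, hyy]
      rw [← hw, mul_add, mul_add]
    rw [← hw] at hyy ⊢
    have hPw : P * w = w := by rw [hw, h.P_mul]
    simp only [mul_add, add_mul, mul_neg, mul_sub, sub_mul, mul_assoc, mul_one, h.Q_mul, hPw,
      ← hw, sub_self]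
    rw [hyy]
    generalize P * (Q * w) = t at hw2 ⊢
    rw [hw2]
    abel
  have hQu : P * (Q * u) = u := by rw [hy0, eq_comm, sub_eq_zero] at hy; exact hy.symm
  -- Now au = u, so bb*u = a²u - au = 0 and therefore b*u = 0.
  have hb : star (P * Q * (1 - P)) * u = 0 := by
    rw [← CStarRing.star_mul_self_eq_zero_iff, star_mul, star_star, hstar u hPu, mul_assoc]
    simp only [mul_neg, mul_sub, sub_mul, mul_assoc, one_mul, h.Q_mul, hQu, hPu, sub_self,
      mul_zero, neg_zero]
  rw [hstar u hPu, neg_eq_zero, hQu, sub_eq_zero] at hb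
  refine ⟨hb, ?_⟩
  rw [hb, hPu, sub_self, eq_comm, neg_eq_zero] at e1
  rw [hb, hPu, sub_self, neg_zero, e1, sub_zero] at e2
  exact e2

/-! ### The partial isometry W -/

/-- The operator `V₁(2P - I) - V₂`. -/
def W (P V₁ V₂ : B) : B := V₁ * (P + P - 1) - V₂

theorem P_mul_W (h : IsPolarPair P Q V₁ V₂) : P * W P V₁ V₂ = V₁ * (P + P - 1) := by
  rw [W, mul_sub, ← mul_assoc, h.P_mul_V₁, h.P_mul_V₂, sub_zero]

theorem eq_zero_of_W_mul (h : IsPolarPair P Q V₁ V₂) {X : B} (hW : W P V₁ V₂ * X = 0)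
    (h₁ : (P - V₁ * star V₁) * X = 0) (h₄ : (1 - P - V₂ * star V₂) * X = 0) : X = 0 := by
  have e1 : V₁ * ((P + P - 1) * X) = 0 := by
    rw [← mul_assoc, ← h.P_mul_W, mul_assoc, hW, mul_zero]
  have e2 : V₂ * X = 0 := by
    rw [W, sub_mul, mul_assoc, e1, zero_sub, neg_eq_zero] at hW
    exact hW
  obtain ⟨q1, q2⟩ := h.Q_mul_of_mul_eq_zero ((h.polar₁.mul_eq_zero_iff _).mpr e1)
    ((h.polar₂.mul_eq_zero_iff _).mpr e2)
  have f1 : P * X = 0 := by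
    rw [← h.proj₁_mul (h.P_mul X) q1, ← mul_assoc, h.proj₁_mul_P, h₁]
  rw [f1, sub_zero] at q2
  rw [← h.proj₄_mul f1 q2, h₄]

theorem V₁_symm_mul_proj₁ (h : IsPolarPair P Q V₁ V₂) :
    V₁ * ((P + P - 1) * (P - V₁ * star V₁)) = 0 := by
  have h5 : (P + P - 1) * (P - V₁ * star V₁) = P - V₁ * star V₁ := by
    rw [sub_mul, add_mul, h.P_mul_proj₁]; simp
  rw [h5, ← h.polar₁.mul_eq_zero_iff, mul_assoc, sub_mul, one_mul, h.Q_mul_proj₁, sub_self,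
    mul_zero]

theorem V₁_symm_mul_proj₄ (h : IsPolarPair P Q V₁ V₂) :
    V₁ * ((P + P - 1) * (1 - P - V₂ * star V₂)) = 0 := by
  have h5 : (P + P - 1) * (1 - P - V₂ * star V₂) = -(1 - P - V₂ * star V₂) := by
    rw [sub_mul, add_mul, h.P_mul_proj₄]; simp
  rw [h5, ← h.polar₁.mul_eq_zero_iff, mul_neg, mul_assoc, sub_mul 1 Q, one_mul, h.Q_mul_proj₄,
    sub_zero, h.P_mul_proj₄, neg_zero]

theorem V₂_mul_proj₁ (h : IsPolarPair P Q V₁ V₂) : V₂ * (P - V₁ * star V₁) = 0 := by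
  rw [← h.polar₂.mul_eq_zero_iff, mul_assoc, h.Q_mul_proj₁, sub_mul, h.P_mul_proj₁, one_mul,
    sub_self]

theorem V₂_mul_proj₄ (h : IsPolarPair P Q V₁ V₂) : V₂ * (1 - P - V₂ * star V₂) = 0 := by
  rw [← h.polar₂.mul_eq_zero_iff, mul_assoc, h.Q_mul_proj₄, mul_zero]

/-- JQ* = QJ makes the factor (1 - Q)Q appear, so T₁JT₂* = 0. The annihilator conditions replace T₁
by V₁ and, after taking adjoints, T₂ by V₂. This kills the cross terms of WW*. -/
theorem V₁_symm_mul_star_V₂ (h : IsPolarPair P Q V₁ V₂) :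
    V₁ * ((P + P - 1) * star V₂) = 0 := by
  have e1 : P * (1 - Q) * ((P + P - 1) * star ((1 - P) * Q)) = 0 := by
    simp only [star_mul, star_sub, h.star_eq, h.proj.isSelfAdjoint.star_eq, mul_add,
      add_mul, mul_sub, sub_mul, mul_assoc, h.P_mul, h.Q_mul, h.proj.isIdempotentElem.eq,
      h.idem.eq, one_mul, mul_one]
    abel
  rw [h.polar₁.mul_eq_zero_iff] at e1
  have hJ : star (P + P - 1) = P + P - 1 := by simp [h.proj.isSelfAdjoint.star_eq]
  have e2 : (1 - P) * Q * ((P + P - 1) * star V₁) = 0 := by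
    simpa [hJ, mul_assoc, h.proj.isSelfAdjoint.star_eq] using congrArg star e1
  rw [h.polar₂.mul_eq_zero_iff] at e2
  simpa [hJ, mul_assoc, h.proj.isSelfAdjoint.star_eq] using congrArg star e2

theorem W_mul_proj₁ (h : IsPolarPair P Q V₁ V₂) : W P V₁ V₂ * (P - V₁ * star V₁) = 0 := by
  rw [W, sub_mul, mul_assoc, h.V₁_symm_mul_proj₁, h.V₂_mul_proj₁, sub_zero]

theorem W_mul_proj₄ (h : IsPolarPair P Q V₁ V₂) : W P V₁ V₂ * (1 - P - V₂ * star V₂) = 0 := by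
  rw [W, sub_mul, mul_assoc, h.V₁_symm_mul_proj₄, h.V₂_mul_proj₄, sub_zero]

theorem proj₁_mul_W (h : IsPolarPair P Q V₁ V₂) : (P - V₁ * star V₁) * W P V₁ V₂ = 0 := by
  rw [W, mul_sub, ← mul_assoc, sub_mul _ _ V₁, sub_mul _ _ V₂, h.polar₁.partialIsometry,
    h.P_mul_V₁, sub_self, h.P_mul_V₂, mul_assoc, h.star_V₁_mul_V₂]
  simp

theorem proj₄_mul_W (h : IsPolarPair P Q V₁ V₂) : (1 - P - V₂ * star V₂) * W P V₁ V₂ = 0 := by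
  rw [W, mul_sub, ← mul_assoc, sub_mul _ _ V₁, sub_mul 1 P V₁, sub_mul _ _ V₂, sub_mul 1 P V₂,
    h.polar₂.partialIsometry, h.P_mul_V₁, h.P_mul_V₂, mul_assoc V₂, h.star_V₂_mul_V₁]
  simp

theorem W_mul_star_W (h : IsPolarPair P Q V₁ V₂) :
    W P V₁ V₂ * star (W P V₁ V₂) = 1 - (P - V₁ * star V₁) - (1 - P - V₂ * star V₂) := by
  have hJ : star (P + P - 1) = P + P - 1 := by simp [h.proj.isSelfAdjoint.star_eq]
  have e := congrArg star h.V₁_symm_mul_star_V₂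
  rw [star_mul, star_mul, star_star, star_zero, hJ] at e
  rw [W, star_sub, star_mul, hJ, sub_mul (V₁ * _), mul_sub (V₁ * _), mul_sub V₂, mul_assoc,
    h.symm_mul_symm, mul_assoc V₁ _ (star V₂), h.V₁_symm_mul_star_V₂, ← mul_assoc V₂, e]
  abel

theorem proj₁_mul_Q (h : IsPolarPair P Q V₁ V₂) :
    (P - V₁ * star V₁) * Q = P - V₁ * star V₁ := by
  have h5 : (P + P - 1) * (P - V₁ * star V₁) = P - V₁ * star V₁ := by
    rw [sub_mul, add_mul, h.P_mul_proj₁]; simp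
  have e : star Q * (P - V₁ * star V₁) = P - V₁ * star V₁ := by
    rw [h.star_eq, mul_assoc, h5, mul_assoc, h.Q_mul_proj₁, h5]
  have e' := congrArg star e
  rwa [star_mul, star_star, h.isStarProjection₁.isSelfAdjoint.star_eq] at e'

theorem proj₄_mul_Q (h : IsPolarPair P Q V₁ V₂) : (1 - P - V₂ * star V₂) * Q = 0 := by
  have h5 : (P + P - 1) * (1 - P - V₂ * star V₂) = -(1 - P - V₂ * star V₂) := by
    rw [sub_mul, add_mul, h.P_mul_proj₄]; simp
  have e : star Q * (1 - P - V₂ * star V₂) = 0 := by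
    rw [h.star_eq, mul_assoc, h5, mul_assoc, mul_neg Q, h.Q_mul_proj₄, neg_zero, mul_zero]
  have e' := congrArg star e
  rwa [star_mul, star_star, h.isStarProjection₄.isSelfAdjoint.star_eq, star_zero] at e'

theorem proj₁_mul_proj₄ (h : IsPolarPair P Q V₁ V₂) :
    (P - V₁ * star V₁) * (1 - P - V₂ * star V₂) = 0 := by
  rw [← h.proj₁_mul_P, mul_assoc, h.P_mul_proj₄, mul_zero]

theorem proj₄_mul_proj₁ (h : IsPolarPair P Q V₁ V₂) :
    (1 - P - V₂ * star V₂) * (P - V₁ * star V₁) = 0 := by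
  rw [← h.P_mul_proj₁, ← mul_assoc, h.proj₄_mul_P, zero_mul]

/-! ### The intertwining relation -/

/-- `W` intertwines `PQ` with `(I - Q)(I - P)`. -/
theorem W_mul_PQ (h : IsPolarPair P Q V₁ V₂) :
    W P V₁ V₂ * (P * Q) = (1 - Q) * (1 - P) * W P V₁ V₂ := by
  set R₁ := V₁ * CFC.abs (P * (1 - Q)) * star V₁ with hR₁
  set R₂ := V₂ * CFC.abs ((1 - P) * Q) * star V₂ with hR₂
  have hR : 0 ≤ R₁ + R₂ := add_nonneg h.polar₁.conj_abs_nonneg h.polar₂.conj_abs_nonneg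
  have r12 : R₁ * V₂ = 0 := by rw [hR₁, mul_assoc, h.star_V₁_mul_V₂, mul_zero]
  have r21 : R₂ * V₁ = 0 := by rw [hR₂, mul_assoc, h.star_V₂_mul_V₁, mul_zero]
  have s12 : R₁ * R₂ = 0 := by rw [hR₂, ← mul_assoc, ← mul_assoc, r12, zero_mul, zero_mul]
  have s21 : R₂ * R₁ = 0 := by rw [hR₁, ← mul_assoc, ← mul_assoc, r21, zero_mul, zero_mul]
  have hRR : (R₁ + R₂) * (R₁ + R₂) =
      P * (1 - Q) * star (P * (1 - Q)) + (1 - P) * Q * star ((1 - P) * Q) := by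
    rw [mul_add, add_mul, add_mul, s12, s21, h.polar₁.conj_abs_mul_self,
      h.polar₂.conj_abs_mul_self]
    simp
  -- R is the positive square root of R², so it inherits the commutation.
  have hRP : Commute (R₁ + R₂) P := commute_of_commute_mul_self hR (hRR ▸ h.commute_P)
  have hRQ : Commute (R₁ + R₂) Q := commute_of_commute_mul_self hR (hRR ▸ h.commute_Q)
  have hRV₁ : (R₁ + R₂) * V₁ = P * (1 - Q) := by
    rw [add_mul, r21, h.polar₁.conj_abs_mul, add_zero]
  have hRV₂ : (R₁ + R₂) * V₂ = (1 - P) * Q := by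
    rw [add_mul, r12, h.polar₂.conj_abs_mul, zero_add]
  have hRW : (R₁ + R₂) * W P V₁ V₂ = P * (1 - Q) * (P + P - 1) - (1 - P) * Q := by
    rw [W, mul_sub, ← mul_assoc, hRV₁, hRV₂]
  -- Both (T₁J - T₂)PQ and (I - Q)(I - P)(T₁J - T₂) equal (I - Q)PQ.
  have hRX : (R₁ + R₂) * (W P V₁ V₂ * (P * Q) - (1 - Q) * (1 - P) * W P V₁ V₂) = 0 := by
    have e : Commute (R₁ + R₂) ((1 - Q) * (1 - P)) :=
      ((Commute.one_right _).sub_right hRQ).mul_right ((Commute.one_right _).sub_right hRP)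
    rw [mul_sub, ← mul_assoc _ (W P V₁ V₂), ← mul_assoc _ ((1 - Q) * (1 - P)), e.eq,
      mul_assoc _ (R₁ + R₂), hRW]
    simp only [mul_add, add_mul, mul_sub, sub_mul, mul_assoc, h.P_mul,
      h.proj.isIdempotentElem.eq, h.idem.eq, one_mul, mul_one]
    abel
  -- R need not be injective: RX = 0 only gives V₁*X = V₂*X = 0. The parts P₁X and P₄X are killed
  -- separately, and P₁ + V₁V₁* + P₄ + V₂V₂* = I.
  have hX₁ : star V₁ * (W P V₁ V₂ * (P * Q) - (1 - Q) * (1 - P) * W P V₁ V₂) = 0 := by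
    refine h.polar₁.star_mul_eq_zero ?_
    rw [← hRV₁, star_mul, hR.isSelfAdjoint.star_eq, mul_assoc, hRX, mul_zero]
  have hX₂ : star V₂ * (W P V₁ V₂ * (P * Q) - (1 - Q) * (1 - P) * W P V₁ V₂) = 0 := by
    refine h.polar₂.star_mul_eq_zero ?_
    rw [← hRV₂, star_mul, hR.isSelfAdjoint.star_eq, mul_assoc, hRX, mul_zero]
  have hP₁ : (P - V₁ * star V₁) * (W P V₁ V₂ * (P * Q) - (1 - Q) * (1 - P) * W P V₁ V₂) = 0 := by
    rw [mul_sub, ← mul_assoc, h.proj₁_mul_W, mul_assoc (1 - Q), ← mul_assoc _ (1 - Q),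
      mul_sub _ 1 Q, h.proj₁_mul_Q]
    simp
  have hP₄ : (1 - P - V₂ * star V₂) *
      (W P V₁ V₂ * (P * Q) - (1 - Q) * (1 - P) * W P V₁ V₂) = 0 := by
    rw [mul_sub, ← mul_assoc, h.proj₄_mul_W, mul_assoc (1 - Q), ← mul_assoc _ (1 - Q),
      mul_sub _ 1 Q, h.proj₄_mul_Q, mul_one, sub_zero, ← mul_assoc _ (1 - P), mul_sub _ 1 P,
      h.proj₄_mul_P, mul_one, sub_zero, h.proj₄_mul_W]
    simp
  rw [sub_mul P, mul_assoc V₁, hX₁, mul_zero, sub_zero] at hP₁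
  rw [sub_mul (1 - P), sub_mul 1 P, mul_assoc V₂, hX₂, hP₁, mul_zero, one_mul, sub_zero,
    sub_zero] at hP₄
  exact sub_eq_zero.mp hP₄

/-! ### Unitarity and the conjugation identity -/

variable {l₁ l₂ l₃ : ℂ}

theorem mem_unitary (h : IsPolarPair P Q V₁ V₂) (hl₁ : ‖l₁‖ = 1) (hl₂ : ‖l₂‖ = 1)
    (hl₃ : ‖l₃‖ = 1) :
    l₁ • W P V₁ V₂ + l₂ • (P - V₁ * star V₁) + l₃ • (1 - P - V₂ * star V₂) ∈ unitary B := by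
  have hl : ∀ l : ℂ, ‖l‖ = 1 → star l * l = 1 := fun l hl => by
    simpa [hl] using Complex.conj_mul' l
  have hl0 : ∀ l : ℂ, ‖l‖ = 1 → l ≠ 0 := fun l hl => norm_ne_zero_iff.mp (by simp [hl])
  have w1 := h.W_mul_proj₁
  have w4 := h.W_mul_proj₄
  have p1w := h.proj₁_mul_W
  have p4w := h.proj₄_mul_W
  have ww := h.W_mul_star_W
  have p14 := h.proj₁_mul_proj₄
  have p41 := h.proj₄_mul_proj₁
  have hinj := fun X => h.eq_zero_of_W_mul (X := X)
  have i1 := h.isStarProjection₁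
  have i4 := h.isStarProjection₄
  generalize W P V₁ V₂ = W at *
  generalize P - V₁ * star V₁ = P₁ at *
  generalize 1 - P - V₂ * star V₂ = P₄ at *
  have w1' : P₁ * star W = 0 := by
    simpa [i1.isSelfAdjoint.star_eq] using congrArg star w1
  have w4' : P₄ * star W = 0 := by
    simpa [i4.isSelfAdjoint.star_eq] using congrArg star w4
  have hUU : (l₁ • W + l₂ • P₁ + l₃ • P₄) * star (l₁ • W + l₂ • P₁ + l₃ • P₄) = 1 := by
    simp only [star_add, star_smul, i1.isSelfAdjoint.star_eq, i4.isSelfAdjoint.star_eq, mul_add,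
      add_mul, smul_mul_smul_comm, w1, w4, w1', w4', ww, p14, p41, i1.isIdempotentElem.eq,
      i4.isIdempotentElem.eq, smul_zero, mul_comm l₁, mul_comm l₂, mul_comm l₃, hl _ hl₁,
      hl _ hl₂, hl _ hl₃, one_smul]
    abel
  refine ⟨?_, hUU⟩
  set U := l₁ • W + l₂ • P₁ + l₃ • P₄ with hU
  -- W*W is never computed: UU* = I reduces the other half to cancelling U on the left. Compressing
  -- by P₁ and P₄ separates the three summands.
  have hz : U * (star U * U - 1) = 0 := by
    rw [mul_sub, ← mul_assoc, hUU, one_mul, mul_one, sub_self]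
  have hP₁U : P₁ * U = l₂ • P₁ := by
    simp [hU, mul_add, p1w, p14, i1.isIdempotentElem.eq]
  have hP₄U : P₄ * U = l₃ • P₄ := by
    simp [hU, mul_add, p4w, p41, i4.isIdempotentElem.eq]
  have z1 : P₁ * (star U * U - 1) = 0 := by
    have := congrArg (P₁ * ·) hz
    simp only [← mul_assoc, hP₁U, mul_zero, smul_mul_assoc] at this
    exact (smul_eq_zero.mp this).resolve_left (hl0 _ hl₂)
  have z4 : P₄ * (star U * U - 1) = 0 := by
    have := congrArg (P₄ * ·) hz
    simp only [← mul_assoc, hP₄U, mul_zero, smul_mul_assoc] at this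
    exact (smul_eq_zero.mp this).resolve_left (hl0 _ hl₃)
  have zW : W * (star U * U - 1) = 0 := by
    have := hz
    rw [hU, add_mul, add_mul, smul_mul_assoc, smul_mul_assoc, smul_mul_assoc, ← hU, z1, z4,
      smul_zero, smul_zero, add_zero, add_zero] at this
    exact (smul_eq_zero.mp this).resolve_left (hl0 _ hl₁)
  exact sub_eq_zero.mp (hinj _ zW z1 z4)

theorem conj_eq (h : IsPolarPair P Q V₁ V₂) (hl₁ : ‖l₁‖ = 1) :
    (l₁ • W P V₁ V₂ + l₂ • (P - V₁ * star V₁) + l₃ • (1 - P - V₂ * star V₂)) *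
        (P - (P - V₁ * star V₁)) * (Q - (P - V₁ * star V₁)) *
        star (l₁ • W P V₁ V₂ + l₂ • (P - V₁ * star V₁) + l₃ • (1 - P - V₂ * star V₂)) =
      (1 - Q - (1 - P - V₂ * star V₂)) * (1 - P - (1 - P - V₂ * star V₂)) := by
  have hl : star l₁ * l₁ = 1 := by simpa [hl₁] using Complex.conj_mul' l₁
  have w1 := h.W_mul_proj₁
  have w4 := h.W_mul_proj₄
  have ww := h.W_mul_star_W
  have wPQ := h.W_mul_PQ
  have p41 := h.proj₄_mul_proj₁
  have Pp1 := h.P_mul_proj₁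
  have p1P := h.proj₁_mul_P
  have p1Q := h.proj₁_mul_Q
  have Pp4 := h.P_mul_proj₄
  have p4P := h.proj₄_mul_P
  have Qp4 := h.Q_mul_proj₄
  have i1 := h.isStarProjection₁
  have i4 := h.isStarProjection₄
  generalize W P V₁ V₂ = W at *
  generalize P - V₁ * star V₁ = P₁ at *
  generalize 1 - P - V₂ * star V₂ = P₄ at *
  have e1 : (P - P₁) * (Q - P₁) = P * Q - P₁ := by
    rw [mul_sub, sub_mul, sub_mul, p1Q, Pp1, i1.isIdempotentElem.eq]
    abel
  have e2 : (l₁ • W + l₂ • P₁ + l₃ • P₄) * (P * Q - P₁) = l₁ • ((1 - Q) * (1 - P) * W) := by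
    have e3 : P₁ * (P * Q - P₁) = 0 := by
      rw [mul_sub, ← mul_assoc, p1P, p1Q, i1.isIdempotentElem.eq, sub_self]
    have e4 : P₄ * (P * Q - P₁) = 0 := by
      rw [mul_sub, ← mul_assoc, p4P, p41, zero_mul, sub_self]
    have e5 : W * (P * Q - P₁) = (1 - Q) * (1 - P) * W := by
      rw [mul_sub, w1, wPQ, sub_zero]
    rw [add_mul, add_mul, smul_mul_assoc, smul_mul_assoc, smul_mul_assoc, e3, e4, e5]
    simp
  -- The conjugate of l₁ here cancels the l₁ of `e2`; l₂ and l₃ meet only zero products.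
  have e6 : W * star (l₁ • W + l₂ • P₁ + l₃ • P₄) = star l₁ • (1 - P₁ - P₄) := by
    rw [star_add, star_add, star_smul, star_smul, star_smul, i1.isSelfAdjoint.star_eq,
      i4.isSelfAdjoint.star_eq, mul_add, mul_add, mul_smul_comm, mul_smul_comm, mul_smul_comm,
      w1, w4, ww]
    simp
  rw [mul_assoc _ (P - P₁), e1, e2, smul_mul_assoc, mul_assoc _ W, e6, mul_smul_comm, smul_smul,
    mul_comm l₁, hl, one_smul]
  simp only [mul_sub, sub_mul, mul_one, one_mul, mul_assoc, Pp1, Pp4, p4P, Qp4,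
    i4.isIdempotentElem.eq, mul_zero]
  abel

end IsPolarPair
end CStarAlgebra


/-! ### Back to operators on the Hilbert module -/

section Adjointable

variable {A E : Type*} [NonUnitalCStarAlgebra A] [PartialOrder A] [StarOrderedRing A]
  [NormedAddCommGroup E] [NormedSpace ℂ E] [SMul A E] [CStarModule A E]

theorem mem_range_iff_of_isIdempotentElem {p : Adj A E} (hp : IsIdempotentElem p) {x : E} :
    x ∈ range p ↔ p.1 x = x := by
  constructor
  · rintro ⟨y, rfl⟩
    exact congrArg (fun T : Adj A E => T.1 y) hp
  · exact fun h => ⟨x, h⟩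

theorem isOrthogonallyComplemented_range {p : Adj A E} (hp : IsStarProjection p) :
    IsOrthogonallyComplemented A (range p) := by
  have hpp : ∀ x, p.1 (p.1 x) = p.1 x := fun x =>
    congrArg (fun T : Adj A E => T.1 x) hp.isIdempotentElem
  constructor
  · have : (range p : Set E) = {x | p.1 x = x} :=
      Set.ext fun x => mem_range_iff_of_isIdempotentElem hp.isIdempotentElem
    rw [this]
    exact isClosed_eq p.1.continuous continuous_id
  · refine eq_top_iff.mpr fun x _ => Submodule.mem_sup.mpr
      ⟨p.1 x, ⟨x, rfl⟩, x - p.1 x, ?_, add_sub_cancel _ _⟩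
    rintro _ ⟨z, rfl⟩
    change inner A (x - p.1 x) (p.1 z) = 0
    rw [← inner_adj_right, hp.isSelfAdjoint.star_eq, map_sub, hpp, sub_self,
      CStarModule.inner_zero_left]

theorem projOnto_eq {M : Submodule ℂ E} (hM : IsOrthogonallyComplemented A M) {p : Adj A E}
    (hp : IsStarProjection p) (hpM : range p = M) : projOnto M hM = p :=
  hM.existsUnique.unique (projOnto_spec M hM) ⟨hp, hpM⟩

/-- The missing fourth corner is the adjoint of `corner₁₂`; the four corners of Q* are then those of
JQJ. -/
theorem IsQuasiProjectionPair.star_eq {P Q : Adj A E} (h : IsQuasiProjectionPair P Q) :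
    star Q = (P + P - 1) * Q * (P + P - 1) := by
  have h₁₁ := h.corner₁₁
  have h₁₂ := h.corner₁₂
  have h₂₂ := h.corner₂₂
  have h₂₁ : (1 - P) * star Q * P = -((1 - P) * Q * P) := by
    have := congrArg star h₁₂
    simp only [star_mul, star_neg, star_sub, star_one, star_star,
      h.isStarProjection.isSelfAdjoint.star_eq, ← mul_assoc] at this
    rw [this, neg_neg]
  have e : star Q = P * star Q * P + P * star Q * (1 - P) + (1 - P) * star Q * P +
      (1 - P) * star Q * (1 - P) := by
    simp only [mul_sub, sub_mul, mul_one, one_mul]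
    abel
  rw [e, h₁₁, h₁₂, h₂₁, h₂₂]
  simp only [mul_add, add_mul, mul_sub, sub_mul, mul_one, one_mul, mul_assoc]
  abel

variable [CompleteSpace E]

/-- If Tx = 0, then x is orthogonal to the closure of R(T*), which contains V*Vx, so ⟨Vx, Vx⟩ = 0.
Conversely V*V fixes R(T*), so TV*V = T. -/
theorem IsPolarDecomposition.apply_eq_zero_iff {T V : Adj A E} (h : IsPolarDecomposition T V)
    (x : E) : T.1 x = 0 ↔ V.1 x = 0 := by
  obtain ⟨hc, hV⟩ := h.star_mul_self
  obtain ⟨hq, hqM⟩ := projOnto_spec _ hc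
  rw [← hV] at hq hqM
  constructor
  · intro hT
    have hcont : Continuous fun y : E => inner A x y :=
      CStarModule.continuous_inner.comp (continuous_const.prodMk continuous_id)
    have h1 : (range (star T) : Set E) ⊆ {y | inner A x y = 0} := by
      rintro _ ⟨y, rfl⟩
      change inner A x ((star T).1 y) = 0
      rw [← inner_adj_left, hT, CStarModule.inner_zero_left]
    have hmem : (star V * V).1 x ∈ (range (star T)).topologicalClosure := hqM ▸ ⟨x, rfl⟩
    have h2 : inner A x ((star V * V).1 x) = 0 :=
      closure_minimal h1 (isClosed_eq hcont continuous_const) hmem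
    have h3 : inner A (V.1 x) (V.1 x) = 0 := by
      rw [inner_adj_left]
      exact h2
    exact CStarModule.inner_self.mp h3
  · intro hVx
    have h1 : star V * V * star T = star T := by
      refine Subtype.ext (ContinuousLinearMap.ext fun y => ?_)
      refine (mem_range_iff_of_isIdempotentElem hq.isIdempotentElem).mp ?_
      rw [hqM]
      exact Submodule.le_topologicalClosure _ ⟨y, rfl⟩
    have h2 : T * (star V * V) = T := by simpa [mul_assoc] using congrArg star h1
    have h3 := congrArg (fun S : Adj A E => S.1 x) h2
    have h4 : T.1 ((star V).1 (V.1 x)) = T.1 x := h3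
    rw [← h4, hVx, map_zero, map_zero]

theorem IsPolarDecomposition.isPolarFactor {T V : Adj A E} (h : IsPolarDecomposition T V) :
    IsPolarFactor T V where
  partialIsometry := h.partialIsometry
  eq_mul_abs := h.eq_mul_abs
  mul_eq_zero_iff X := by
    have key : ∀ S : Adj A E, S * X = 0 ↔ ∀ x, S.1 (X.1 x) = 0 := fun S =>
      ⟨fun hS x => congrArg (fun R : Adj A E => R.1 x) hS,
        fun hS => Subtype.ext (ContinuousLinearMap.ext hS)⟩
    simp only [key, h.apply_eq_zero_iff]

/-- The vector form of `IsPolarFactor.star_mul_eq_zero`, needed because membership in H₁ or H₄ is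
tested on vectors. -/
theorem IsPolarDecomposition.star_apply_eq_zero {T V : Adj A E} (h : IsPolarDecomposition T V)
    {x : E} (hx : (star T).1 x = 0) : (star V).1 x = 0 := by
  have e1 : (CFC.abs T).1 ((star V).1 x) = 0 := by
    rw [h.isPolarFactor.star_eq_abs_mul] at hx
    exact hx
  have e2 : T.1 ((star V).1 x) = 0 := by
    have : T.1 ((star V).1 x) = V.1 ((CFC.abs T).1 ((star V).1 x)) :=
      congrArg (fun S : Adj A E => S.1 ((star V).1 x)) h.eq_mul_abs
    rw [this, e1, map_zero]
  have e3 := (h.apply_eq_zero_iff _).mp e2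
  have e4 : (star V).1 (V.1 ((star V).1 x)) = (star V).1 x :=
    congrArg (fun S : Adj A E => S.1 x) h.isPolarFactor.star_mul_mul_star
  rw [← e4, e3, map_zero]

variable {P Q V₁ V₂ : Adj A E}

theorem IsSemiHarmonious.isPolarPair (h : IsSemiHarmonious P Q)
    (hV₁ : IsPolarDecomposition (T₁ P Q) V₁) (hV₂ : IsPolarDecomposition (T₂ P Q) V₂) :
    IsPolarPair P Q V₁ V₂ where
  proj := h.isQuasiProjectionPair.isStarProjection
  idem := h.isQuasiProjectionPair.isIdempotentElem
  star_eq := h.isQuasiProjectionPair.star_eq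
  polar₁ := hV₁.isPolarFactor
  polar₂ := hV₂.isPolarFactor

theorem range_proj₁ (h : IsPolarPair P Q V₁ V₂) (hV₁ : IsPolarDecomposition (T₁ P Q) V₁) :
    range (P - V₁ * star V₁) = H₁ P Q := by
  ext x
  rw [mem_range_iff_of_isIdempotentElem h.isStarProjection₁.isIdempotentElem]
  change _ ↔ x ∈ range P ∧ x ∈ range Q
  rw [mem_range_iff_of_isIdempotentElem h.proj.isIdempotentElem,
    mem_range_iff_of_isIdempotentElem h.idem]
  constructor
  · intro hx
    constructor <;> nth_rw 1 [← hx] <;> nth_rw 2 [← hx]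
    · exact congrArg (fun S : Adj A E => S.1 x) h.P_mul_proj₁
    · exact congrArg (fun S : Adj A E => S.1 x) h.Q_mul_proj₁
  · rintro ⟨hP, hQ⟩
    have e : star (T₁ P Q) = P - (P * Q * P + P * Q * P - Q * P) := by
      simp only [T₁, star_mul, star_sub, h.star_eq, h.proj.isSelfAdjoint.star_eq,
        add_mul, mul_add, mul_sub, sub_mul, mul_assoc, h.proj.isIdempotentElem.eq, one_mul, mul_one]
      abel
    have hT : (star (T₁ P Q)).1 x = 0 := by
      rw [e]
      change P.1 x - (P.1 (Q.1 (P.1 x)) + P.1 (Q.1 (P.1 x)) - Q.1 (P.1 x)) = 0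
      rw [hP, hQ, hP, add_sub_cancel_right, sub_self]
    change P.1 x - V₁.1 ((star V₁).1 x) = x
    rw [hV₁.star_apply_eq_zero hT, map_zero, hP, sub_zero]

theorem range_proj₄ (h : IsPolarPair P Q V₁ V₂) (hV₂ : IsPolarDecomposition (T₂ P Q) V₂) :
    range (1 - P - V₂ * star V₂) = H₄ P Q := by
  ext x
  rw [mem_range_iff_of_isIdempotentElem h.isStarProjection₄.isIdempotentElem]
  change _ ↔ P.1 x = 0 ∧ Q.1 x = 0
  constructor
  · intro hx
    constructor <;> rw [← hx]
    · exact congrArg (fun S : Adj A E => S.1 x) h.P_mul_proj₄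
    · exact congrArg (fun S : Adj A E => S.1 x) h.Q_mul_proj₄
  · rintro ⟨hP, hQ⟩
    have e : star (T₂ P Q) = (P + P - 1) * (Q * (P - 1)) := by
      simp only [T₂, star_mul, star_sub, h.star_eq, h.proj.isSelfAdjoint.star_eq,
        add_mul, mul_add, mul_sub, sub_mul, mul_assoc, h.proj.isIdempotentElem.eq, one_mul, mul_one]
      abel
    have hT : (star (T₂ P Q)).1 x = 0 := by
      rw [e]
      change (P + P - 1).1 (Q.1 (P.1 x - x)) = 0
      rw [hP, zero_sub, map_neg, hQ, neg_zero, map_zero]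
    change x - P.1 x - V₂.1 ((star V₂).1 x) = x
    rw [hV₂.star_apply_eq_zero hT, map_zero, hP, sub_zero, sub_zero]

end Adjointable

end HilbertModule

theorem mainTheorem4 {A E : Type*} [NonUnitalCStarAlgebra A] [PartialOrder A] [StarOrderedRing A]
    [NormedAddCommGroup E] [NormedSpace ℂ E] [SMul A E] [CStarModule A E] [CompleteSpace E]
    (P Q V₁ V₂ : HilbertModule.Adj A E)
    (hPQ : HilbertModule.IsSemiHarmonious P Q)
    (hV₁ : HilbertModule.IsPolarDecomposition (HilbertModule.T₁ P Q) V₁)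
    (hV₂ : HilbertModule.IsPolarDecomposition (HilbertModule.T₂ P Q) V₂) :
    ∃ (h₁ : HilbertModule.IsOrthogonallyComplemented A (HilbertModule.H₁ P Q))
      (h₄ : HilbertModule.IsOrthogonallyComplemented A (HilbertModule.H₄ P Q)),
      ∀ (P₁ P₄ U : HilbertModule.Adj A E) (l₁ l₂ l₃ : ℂ),
        P₁ = HilbertModule.projOnto (HilbertModule.H₁ P Q) h₁ →
        P₄ = HilbertModule.projOnto (HilbertModule.H₄ P Q) h₄ →
        ‖l₁‖ = 1 → ‖l₂‖ = 1 → ‖l₃‖ = 1 →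
        U = l₁ • (V₁ * (2 * P - 1) - V₂) + l₂ • P₁ + l₃ • P₄ →
        U ∈ unitary (HilbertModule.Adj A E) ∧
        U * (P - P₁) * (Q - P₁) * star U = (1 - Q - P₄) * (1 - P - P₄) := by
  have h := hPQ.isPolarPair hV₁ hV₂
  have r₁ := HilbertModule.range_proj₁ h hV₁
  have r₄ := HilbertModule.range_proj₄ h hV₂
  have h₁ : HilbertModule.IsOrthogonallyComplemented A (HilbertModule.H₁ P Q) :=
    r₁ ▸ HilbertModule.isOrthogonallyComplemented_range h.isStarProjection₁
  have h₄ : HilbertModule.IsOrthogonallyComplemented A (HilbertModule.H₄ P Q) :=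
    r₄ ▸ HilbertModule.isOrthogonallyComplemented_range h.isStarProjection₄
  refine ⟨h₁, h₄, ?_⟩
  rintro P₁ P₄ U l₁ l₂ l₃ hP₁ hP₄ hl₁ hl₂ hl₃ rfl
  rw [HilbertModule.projOnto_eq h₁ h.isStarProjection₁ r₁] at hP₁
  rw [HilbertModule.projOnto_eq h₄ h.isStarProjection₄ r₄] at hP₄
  subst hP₁ hP₄
  rw [two_mul]
  exact ⟨h.mem_unitary hl₁ hl₂ hl₃, h.conj_eq hl₁⟩
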